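/- Let $k$ be a finite field and let $X$ be a smooth projective variety over $k$ (geometrically integral) of dimension $r$. Let $\mathcal D=(D_1,\dots,D_r)$ be effective divisors on $X$ (over $k$) that intersect properly, i.e. every irreducible component of the set-theoretic intersection $\bigcap_l D_l:=\bigcap_l \operatorname{Supp}(D_l)$ has codimension $r$ in $X$. Let $\mathcal P\subseteq\bigcap_l D_l$ be any set of $k$-rational points of $X$. At each $P\in\bigcap_l D_l$ one may choose generators $\mathbf x=(x_1,\dots,x_r)$ of the maximal ideal $m_P$ of the local ring $\mathcal O_P$, local equations $\mathbf f=(f_1,\dots,f_r)$ of $D_1,\dots,D_r$ at $P$, an integer $a>0$ with $x_i^a\in(f_1,\dots,f_r)\mathcal O_P$ for all $i$, and elements $r_{ij}\in\mathcal O_P$ with $x_i^a=\sum_j r_{ij}f_j$; put $R_P(\mathbf x,\mathbf f,a):=\det(r_{ij})\in\mathcal O_P$. A rational function $\theta\in k(X)$ is called $(\mathcal D,\mathcal P)$-rectifying if it is regular at every point of $\bigcap_l D_l$ and, for all such choices at each $P\in\bigcap_l D_l$, 1. if $P\in\mathcal P$, then $R_P(\mathbf x,\mathbf f,a)\,\theta\equiv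 c\,x_1^{a-1}\cdots x_r^{a-1}\pmod{(x_1^a,\dots,x_r^a)}$ for some $c\in k$; 2. if $P\notin\mathcal P$, then $R_P(\mathbf x,\mathbf f,a)\,\theta\equiv 0\pmod{(x_1^a,\dots,x_r^a)}$. It is called strictly $(\mathcal D,\mathcal P)$-rectifying if moreover the constants $c$ in (1) can be taken to be nonzero for every $P\in\mathcal P$ and all choices. Then there exists a $(\mathcal D,\mathcal P)$-rectifying function $\theta\in k(X)$; indeed, there exists a strictly $(\mathcal D,\mathcal P)$-rectifying one. -/

import Mathlib

open AlgebraicGeometry CategoryTheory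

universe u

namespace RectifyingFunctions

noncomputable section

/-! ### Varieties over a field -/

attribute [local instance] MvPolynomial.gradedAlgebra

/-- Projective `n`-space over `k`, as the `Proj` of the standard graded polynomial ring. -/
def projSpace (k : Type u) [Field k] (n : ℕ) : Scheme.{u} :=
  Proj (MvPolynomial.homogeneousSubmodule (Fin (n + 1)) k)

/-- The structure morphism of projective `n`-space over `k`. -/
def projSpaceStr (k : Type u) [Field k] (n : ℕ) : projSpace k n ⟶ Spec (.of k) :=
  Proj.toSpecZero (MvPolynomial.homogeneousSubmodule (Fin (n + 1)) k) ≫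
    Spec.map (CommRingCat.ofHom
      (algebraMap k (MvPolynomial.homogeneousSubmodule (Fin (n + 1)) k 0)))

/-- A `k`-scheme is projective if it is a closed subscheme of some projective space over `k`. -/
def IsProjective {k : Type u} [Field k] {X : Scheme.{u}} (π : X ⟶ Spec (.of k)) : Prop :=
  ∃ (n : ℕ) (i : X ⟶ projSpace k n), IsClosedImmersion i ∧ i ≫ projSpaceStr k n = π

/-- `X` is a smooth projective variety of dimension `r` over `k`. A variety over `k` is a
geometrically integral separated scheme of finite type over `k`; separatedness and finite type
are contained in projectivity. -/
structure IsSmoothProjectiveVariety {k : Type u} [Field k] {X : Scheme.{u}}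
    (π : X ⟶ Spec (.of k)) (r : ℕ) : Prop where
  geometricallyIntegral : GeometricallyIntegral π
  smooth : Smooth π
  projective : IsProjective π
  dim_eq : topologicalKrullDim X = r

/-- A point `P` of a `k`-scheme is `k`-rational if it is the image of a section of the structure
morphism. -/
def IsRationalPoint {k : Type u} [Field k] {X : Scheme.{u}} (π : X ⟶ Spec (.of k)) (P : X) :
    Prop :=
  ∃ s : Spec (.of k) ⟶ X, s ≫ π = 𝟙 _ ∧ ∃ y : Spec (.of k), s y = P

/-- The constants `k → 𝒪_P`. -/
def constants {k : Type u} [Field k] {X : Scheme.{u}} (π : X ⟶ Spec (.of k)) (P : X) :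
    k →+* X.presheaf.stalk P :=
  ((Scheme.ΓSpecIso (.of k)).inv ≫ π.appTop ≫ X.presheaf.germ ⊤ P trivial).hom

/-! ### Effective divisors -/

/-- An effective divisor: a quasi-coherent ideal sheaf which near every point is generated by one
nonzerodivisor (on a smooth variety these are the same as effective Weil divisors). -/
structure EffectiveDivisor (X : Scheme.{u}) where
  idealSheaf : X.IdealSheafData
  locallyPrincipal : ∀ P : X, ∃ U : X.affineOpens, P ∈ U.1 ∧
    ∃ g ∈ nonZeroDivisors Γ(X, U.1), idealSheaf.ideal U = Ideal.span {g}

/-- `f ∈ 𝒪_P` is a local equation of `D` at `P`: it is the germ of a section that generates the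
ideal of `D` on an affine open neighbourhood of `P`. -/
def EffectiveDivisor.IsLocalEquation {X : Scheme.{u}} (D : EffectiveDivisor X) (P : X)
    (f : X.presheaf.stalk P) : Prop :=
  ∃ (U : X.affineOpens) (hP : P ∈ U.1) (g : Γ(X, U.1)),
    D.idealSheaf.ideal U = Ideal.span {g} ∧ X.presheaf.germ U.1 P hP g = f

/-- The set-theoretic intersection of the supports of the divisors `D_l`. -/
def inter {X : Scheme.{u}} {r : ℕ} (D : Fin r → EffectiveDivisor X) : Set X :=
  {P | ∀ l, P ∈ (D l).idealSheaf.support}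

/-- `r` effective divisors intersect properly if every irreducible component of the intersection
of their supports has codimension `r`. The generic points of these components are the points of
the intersection without a proper generization in it, and the codimension of a component is the
dimension of the local ring at its generic point. -/
def IntersectProperly {X : Scheme.{u}} {r : ℕ} (D : Fin r → EffectiveDivisor X) : Prop :=
  ∀ P ∈ inter D, (∀ Q ∈ inter D, Q ⤳ P → Q = P) → ringKrullDim (X.presheaf.stalk P) = r

/-! ### Rectifying functions -/

/-- The auxiliary choices at a point `P`: generators `x_1, …, x_r` of `m_P`, local equations
`f_1, …, f_r` of `D_1, …, D_r` at `P`, an exponent `a > 0` with `x_i ^ a ∈ (f_1, …, f_r)` for all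
`i`, and a matrix `(r_ij)` over `𝒪_P` with `x_i ^ a = ∑ j, r_ij f_j`. -/
structure LocalChoice {X : Scheme.{u}} {r : ℕ} (D : Fin r → EffectiveDivisor X) (P : X) where
  x : Fin r → X.presheaf.stalk P
  f : Fin r → X.presheaf.stalk P
  a : ℕ
  M : Matrix (Fin r) (Fin r) (X.presheaf.stalk P)
  span_x : Ideal.span (Set.range x) = IsLocalRing.maximalIdeal (X.presheaf.stalk P)
  isLocalEquation : ∀ j, (D j).IsLocalEquation P (f j)
  a_pos : 0 < a
  pow_eq : ∀ i, x i ^ a = ∑ j, M i j * f j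

namespace LocalChoice

variable {X : Scheme.{u}} {r : ℕ} {D : Fin r → EffectiveDivisor X} {P : X}

/-- `R_P(x, f, a) = det (r_ij)`. -/
def R (L : LocalChoice D P) : X.presheaf.stalk P := L.M.det

/-- The ideal `(x_1 ^ a, …, x_r ^ a)` of `𝒪_P`. -/
def powIdeal (L : LocalChoice D P) : Ideal (X.presheaf.stalk P) :=
  Ideal.span (Set.range fun i => L.x i ^ L.a)

/-- The monomial `x_1 ^ (a - 1) ⋯ x_r ^ (a - 1)`. -/
def topMonomial (L : LocalChoice D P) : X.presheaf.stalk P := ∏ i, L.x i ^ (L.a - 1)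

end LocalChoice

/-- `θ ∈ k(X)` is `(𝒟, S)`-rectifying: it is regular at every point `P` of `⋂ D_l`, and modulo
`(x_1 ^ a, …, x_r ^ a)` the product `R_P(x, f, a) θ` is `c x_1 ^ (a - 1) ⋯ x_r ^ (a - 1)` with
`c ∈ k` if `P ∈ S`, and is `0` if `P ∉ S`. This is required for all choices at `P` (whether it
holds does not depend on them). The ideal `(x_1 ^ a, …, x_r ^ a)` contains a power of `m_P`, so
the congruences may be read in `𝒪_P` instead of in its completion, the ring of power series. -/
def IsRectifying {k : Type u} [Field k] {X : Scheme.{u}} [IsIntegral X] (π : X ⟶ Spec (.of k))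
    {r : ℕ} (D : Fin r → EffectiveDivisor X) (S : Set X) (θ : X.functionField) : Prop :=
  ∀ P ∈ inter D, ∃ t : X.presheaf.stalk P,
    algebraMap (X.presheaf.stalk P) X.functionField t = θ ∧
    ∀ L : LocalChoice D P,
      (P ∈ S → ∃ c : k, L.R * t - constants π P c * L.topMonomial ∈ L.powIdeal) ∧
      (P ∉ S → L.R * t ∈ L.powIdeal)

/-- `θ` is strictly `(𝒟, S)`-rectifying: it is `(𝒟, S)`-rectifying and the constants `c` at the
points of `S` are nonzero. -/
def IsStrictlyRectifying {k : Type u} [Field k] {X : Scheme.{u}} [IsIntegral X]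
    (π : X ⟶ Spec (.of k)) {r : ℕ} (D : Fin r → EffectiveDivisor X) (S : Set X)
    (θ : X.functionField) : Prop :=
  ∀ P ∈ inter D, ∃ t : X.presheaf.stalk P,
    algebraMap (X.presheaf.stalk P) X.functionField t = θ ∧
    ∀ L : LocalChoice D P,
      (P ∈ S → ∃ c : k, c ≠ 0 ∧ L.R * t - constants π P c * L.topMonomial ∈ L.powIdeal) ∧
      (P ∉ S → L.R * t ∈ L.powIdeal)

end

end RectifyingFunctions

/-!
The points of `⋂ D_l` are closed: the minimal ones have local rings of dimension `r = dim X`, and a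
proper specialization would have a local ring of larger dimension. Hence `⋂ D_l` is finite, and the
claim splits into a local part at each point and a gluing part.

*Local part.* Let `P` be a point of `⋂ D_l`. Generators `x_1, …, x_r` of `m_P` form a regular
sequence, since `dim 𝒪_P = r` (`isDomain_of_span_eq_maximalIdeal`, `mem_span_image_Iio_of_mul_mem`).
The determinant of a matrix `B` is therefore determined by the vector `B x` modulo the ideal of its
entries (`det_sub_det_mem`): changing a row of `B` changes it by a syzygy of `x`, and all such
syzygies are trivial. Write the local equations as `f = B x` and put `t = det B`; classically, `t`
generates the socle of `𝒪_P / (f)`. If `x_i ^ a = ∑ M_ij f_j`, then `M B` and the diagonal matrix of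
the `x_i ^ (a - 1)` both send `x` to the vector of the `x_i ^ a`, so that
`det M * t ≡ ∏ x_i ^ (a - 1)` modulo `(x_1 ^ a, …, x_r ^ a)`. Other generators and local equations
change `t` by a unit factor modulo `(f)` only (`exists_isUnit_det_mul_det_sub_mem`), and
`det M * (f) ⊆ (x_1 ^ a, …, x_r ^ a)`. So one germ `t` serves all choices at once, up to units. At a
rational point a unit is a nonzero constant modulo `m_P`, and `m_P` kills the top monomial modulo
the powers: the class of `t` modulo `(f)` satisfies the strict condition at the points of `S`, and
the class of `0` the condition at the other points.

*Gluing.* The ideal `(f)` contains a power of `m_P`, so only the class of `θ` modulo a power of each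
`m_P` matters. By homogeneous prime avoidance the finitely many points lie in one affine open of the
projective scheme `X` (`exists_affineOpens_of_finite`), and the Chinese remainder theorem there
yields a section with the prescribed classes (`exists_section_forall_germ_sub_mem`).
-/

namespace RectifyingFunctions

open IsLocalRing

/-! ### Regular local rings -/

section RegularLocal

/-- Among the primes of a ring of dimension at least `n` there is one whose quotient still has
dimension at least `n`: the bottom of a chain of length `n`. -/
theorem exists_prime_le_ringKrullDim_quotient {R : Type*} [CommRing R] {n : ℕ}
    (h : (n : WithBot ℕ∞) ≤ ringKrullDim R) :
    ∃ p : Ideal R, p.IsPrime ∧ (n : WithBot ℕ∞) ≤ ringKrullDim (R ⧸ p) := by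
  obtain ⟨l, hl⟩ := Order.le_krullDim_iff.mp h
  refine ⟨l.head.asIdeal, l.head.isPrime, ?_⟩
  rw [ringKrullDim_quotient]
  refine Order.le_krullDim_iff.mpr ⟨⟨l.length, fun i => ⟨l i, ?_⟩, fun i => l.step i⟩, hl⟩
  exact (PrimeSpectrum.mem_zeroLocus _ _).mpr (l.head_le i)

theorem ringKrullDim_le_of_span_eq_maximalIdeal {R : Type*} [CommRing R] [IsLocalRing R]
    [IsNoetherianRing R] {s : Set R} (hs : Ideal.span s = maximalIdeal R) {n : ℕ}
    (hn : s.encard ≤ n) : ringKrullDim R ≤ n := by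
  refine (ringKrullDim_le_spanFinrank_maximalIdeal R).trans ?_
  have h := (Submodule.spanFinrank_span_le_encard (R := R) s).trans hn
  rw [← Ideal.submodule_span_eq] at hs
  rw [hs] at h
  exact_mod_cast h

theorem span_image_mk_diff_eq_maximalIdeal {R : Type*} [CommRing R] [IsLocalRing R]
    {s t : Set R} {I : Ideal R} [IsLocalRing (R ⧸ I)]
    (hs : Ideal.span s = maximalIdeal R) (ht : t ⊆ I) :
    Ideal.span (Ideal.Quotient.mk I '' (s \ t)) = maximalIdeal (R ⧸ I) := by
  rw [← map_maximalIdeal_of_surjective _ (Ideal.Quotient.mk_surjective (I := I)), ← hs,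
    Ideal.map_span]
  refine le_antisymm (Ideal.span_mono (Set.image_mono Set.sdiff_subset)) ?_
  rw [Ideal.span_le]
  rintro _ ⟨y, hy, rfl⟩
  by_cases hyt : y ∈ t
  · rw [Ideal.Quotient.eq_zero_iff_mem.mpr (ht hyt)]
    exact zero_mem _
  · exact Ideal.subset_span ⟨y, ⟨hy, hyt⟩, rfl⟩

/-- A Noetherian local ring whose maximal ideal has `dim R` generators is a domain. By induction
`R ⧸ (x)` is a domain for a generator `x`. A prime `p` with `dim R ⧸ p = dim R` does not contain `x`,
and `p ⊆ (x)` by comparing dimensions; then `p = x p`, and `p = 0` by Nakayama. -/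
theorem isDomain_of_span_eq_maximalIdeal {R : Type*} [CommRing R] [IsLocalRing R]
    [IsNoetherianRing R] {s : Set R} (hs : Ideal.span s = maximalIdeal R) {n : ℕ}
    (hn : s.encard ≤ n) (hdim : (n : WithBot ℕ∞) ≤ ringKrullDim R) : IsDomain R := by
  induction n generalizing R with
  | zero =>
    have h0 : s = ∅ := by simpa using hn
    rw [h0, Ideal.span_empty] at hs
    exact (isField_iff_maximalIdeal_eq.mpr hs.symm).isDomain
  | succ n ih =>
    obtain ⟨x, hx⟩ : s.Nonempty := by
      rw [Set.nonempty_iff_ne_empty]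
      rintro rfl
      have h := hdim.trans (ringKrullDim_le_of_span_eq_maximalIdeal hs (n := 0) (by simp))
      exact absurd h (by norm_cast)
    have hcard : (s \ {x}).encard ≤ n := by
      rw [← Set.encard_sdiff_singleton_add_one hx] at hn
      push_cast at hn
      exact (ENat.add_le_add_iff_right ENat.one_ne_top).mp hn
    have hcard' : ∀ I : Ideal R, (Ideal.Quotient.mk I '' (s \ {x})).encard ≤ n :=
      fun I => (Set.encard_image_le _ _).trans hcard
    have hxm : x ∈ maximalIdeal R := hs ▸ Ideal.subset_span hx
    have key : ∀ (A : Type _) [CommRing A] [IsLocalRing A] [IsNoetherianRing A] (a : A),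
        a ∈ maximalIdeal A → ((n + 1 : ℕ) : WithBot ℕ∞) ≤ ringKrullDim A →
        (n : WithBot ℕ∞) ≤ ringKrullDim (A ⧸ Ideal.span {a}) := by
      intro A _ _ _ a ha hA
      have h := hA.trans (ringKrullDim_le_ringKrullDim_quotient_add_encard {a} (by
        simpa [ringJacobson_eq_maximalIdeal] using ha))
      rw [Set.encard_singleton] at h
      exact (ENat.WithBot.add_le_add_one_right_iff).mp (by simpa using h)
    obtain ⟨p, hp, hpdim⟩ := exists_prime_le_ringKrullDim_quotient hdim
    -- Otherwise the maximal ideal of `R ⧸ p` would have only `n` generators.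
    have hxp : x ∉ p := by
      intro hxp
      have : IsLocalRing (R ⧸ p) := .of_surjective' _ Ideal.Quotient.mk_surjective
      have h := hpdim.trans (ringKrullDim_le_of_span_eq_maximalIdeal
        (span_image_mk_diff_eq_maximalIdeal hs (t := {x}) (by simpa using hxp)) (hcard' p))
      exact absurd h (by norm_cast; omega)
    set I := Ideal.span {x} with hI
    have hxI : ({x} : Set R) ⊆ I := Ideal.subset_span
    have : Nontrivial (R ⧸ I) := Ideal.Quotient.nontrivial_iff.mpr fun h => by
      have : I ≤ maximalIdeal R := by simpa [hI, Ideal.span_le] using hxm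
      exact (maximalIdeal.isMaximal R).ne_top (top_le_iff.mp (h ▸ this))
    have : IsLocalRing (R ⧸ I) := .of_surjective' _ Ideal.Quotient.mk_surjective
    have hspan := span_image_mk_diff_eq_maximalIdeal hs hxI
    have hdom : IsDomain (R ⧸ I) := ih hspan (hcard' I) (key R x hxm hdim)
    -- `(R ⧸ p) ⧸ (x)` has dimension `n`, so it is not a proper quotient of the `n`-dimensional
    -- domain `R ⧸ (x)`.
    have hpI : p ≤ I := by
      intro y hy
      by_contra hyI
      have hlt := ringKrullDim_quotient_succ_le_of_nonZeroDivisor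
        (mem_nonZeroDivisors_of_ne_zero fun h => hyI (Ideal.Quotient.eq_zero_iff_mem.mp h) :
          Ideal.Quotient.mk I y ∈ nonZeroDivisors (R ⧸ I))
      have hle := ringKrullDim_le_of_span_eq_maximalIdeal hspan (hcard' I)
      have : IsLocalRing (R ⧸ p) := .of_surjective' _ Ideal.Quotient.mk_surjective
      have hge := key (R ⧸ p) (Ideal.Quotient.mk p x)
        (by rw [← map_maximalIdeal_of_surjective _ (Ideal.Quotient.mk_surjective (I := p))]
            exact Ideal.mem_map_of_mem _ hxm) hpdim
      let φ : R ⧸ I →+* (R ⧸ p) ⧸ Ideal.span {Ideal.Quotient.mk p x} :=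
        Ideal.Quotient.lift I ((Ideal.Quotient.mk _).comp (Ideal.Quotient.mk p)) (by
          intro a ha
          obtain ⟨b, rfl⟩ := Ideal.mem_span_singleton'.mp ha
          simp [Ideal.Quotient.eq_zero_iff_mem.mpr (Ideal.mem_span_singleton_self _)])
      let ψ : (R ⧸ I) ⧸ Ideal.span {Ideal.Quotient.mk I y} →+*
          (R ⧸ p) ⧸ Ideal.span {Ideal.Quotient.mk p x} :=
        Ideal.Quotient.lift _ φ (by
          intro a ha
          obtain ⟨b, rfl⟩ := Ideal.mem_span_singleton'.mp ha
          simp [φ, Ideal.Quotient.eq_zero_iff_mem.mpr hy])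
      have hψ : Function.Surjective ψ :=
        Ideal.Quotient.lift_surjective_of_surjective _ _
          (Ideal.Quotient.lift_surjective_of_surjective _ _
            (Ideal.Quotient.mk_surjective.comp Ideal.Quotient.mk_surjective))
      have h1 := hge.trans (ringKrullDim_le_of_surjective ψ hψ)
      have h2 : ((n : WithBot ℕ∞)) + 1 ≤ n := by
        refine le_trans ?_ (hlt.trans hle)
        gcongr
      exact absurd h2 (by norm_cast; omega)
    have hbot : p = ⊥ := by
      refine Submodule.eq_bot_of_le_smul_of_le_jacobson_bot I p (IsNoetherian.noetherian p) ?_ ?_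
      · intro y hy
        obtain ⟨b, rfl⟩ := Ideal.mem_span_singleton'.mp (hpI hy)
        rw [mul_comm]
        exact Submodule.smul_mem_smul (Ideal.mem_span_singleton_self x)
          ((hp.mem_or_mem hy).resolve_right hxp)
      · rw [jacobson_eq_maximalIdeal ⊥ bot_ne_top]
        simpa [hI, Ideal.span_le] using hxm
    subst hbot
    exact IsDomain.of_bot_isPrime R

/-- Generators `x_1, …, x_n` of the maximal ideal of a Noetherian local ring of dimension `n` form
a regular sequence: the quotient by `x_1, …, x_{i-1}` is again regular local, hence a domain, and
`x_i` is nonzero in it for dimension reasons. -/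
theorem mem_span_image_Iio_of_mul_mem {R : Type*} [CommRing R] [IsLocalRing R]
    [IsNoetherianRing R] {n : ℕ} {x : Fin n → R}
    (hx : Ideal.span (Set.range x) = maximalIdeal R) (hdim : (n : WithBot ℕ∞) ≤ ringKrullDim R)
    (i : Fin n) {a : R} (ha : a * x i ∈ Ideal.span (x '' Set.Iio i)) :
    a ∈ Ideal.span (x '' Set.Iio i) := by
  set I := Ideal.span (x '' Set.Iio i) with hI
  have hxm : ∀ j, x j ∈ maximalIdeal R := fun j => hx ▸ Ideal.subset_span ⟨j, rfl⟩
  have hIm : I ≤ maximalIdeal R := by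
    rw [hI, Ideal.span_le]
    rintro _ ⟨j, -, rfl⟩
    exact hxm j
  have : Nontrivial (R ⧸ I) := Ideal.Quotient.nontrivial_iff.mpr fun h =>
    (maximalIdeal.isMaximal R).ne_top (top_le_iff.mp (h ▸ hIm))
  have : IsLocalRing (R ⧸ I) := .of_surjective' _ Ideal.Quotient.mk_surjective
  have hq : ((n - i : ℕ) : WithBot ℕ∞) ≤ ringKrullDim (R ⧸ I) := by
    have h := hdim.trans (ringKrullDim_le_ringKrullDim_quotient_add_encard (x '' Set.Iio i) (by
      rw [ringJacobson_eq_maximalIdeal]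
      rintro _ ⟨j, -, rfl⟩
      exact hxm j))
    have hc : (x '' Set.Iio i).encard ≤ ((i : ℕ) : ℕ∞) := by
      refine (Set.encard_image_le _ _).trans (le_of_eq ?_)
      rw [← Finset.coe_Iio, Set.encard_coe_eq_coe_finsetCard, Fin.card_Iio]
    have h2 : ((n - i : ℕ) : WithBot ℕ∞) + ((i : ℕ) : WithBot ℕ∞) ≤
        ringKrullDim (R ⧸ I) + ((i : ℕ) : WithBot ℕ∞) := by
      rw [← Nat.cast_add, Nat.sub_add_cancel i.2.le]
      refine h.trans ?_
      gcongr
      exact_mod_cast hc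
    exact ENat.WithBot.add_le_add_natCast_right_iff.mp h2
  have hsub : x '' Set.Iio i ⊆ I := Ideal.subset_span
  have hspan := span_image_mk_diff_eq_maximalIdeal hx hsub
  have hcard : (Ideal.Quotient.mk I '' (Set.range x \ x '' Set.Iio i)).encard ≤
      ((n - i : ℕ) : ℕ∞) := by
    refine (Set.encard_image_le _ _).trans ((Set.encard_le_encard (t := x '' Set.Ici i) ?_).trans
      ((Set.encard_image_le _ _).trans (le_of_eq ?_)))
    · rintro _ ⟨⟨j, rfl⟩, hj⟩
      exact ⟨j, Set.mem_Ici.mpr <| not_lt.mp fun h => hj ⟨j, h, rfl⟩, rfl⟩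
    · rw [← Finset.coe_Ici, Set.encard_coe_eq_coe_finsetCard, Fin.card_Ici]
  have hdom := isDomain_of_span_eq_maximalIdeal hspan hcard hq
  have hprime : I.IsPrime := (Ideal.Quotient.isDomain_iff_prime I).mp hdom
  refine (hprime.mem_or_mem ha).resolve_right fun hxi => ?_
  have hsub' : x '' Set.Iic i ⊆ I := by
    rintro _ ⟨j, hj, rfl⟩
    obtain rfl | hj := eq_or_lt_of_le (Set.mem_Iic.mp hj)
    · exact hxi
    · exact hsub ⟨j, hj, rfl⟩
  have hcard' : (Ideal.Quotient.mk I '' (Set.range x \ x '' Set.Iic i)).encard ≤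
      ((n - 1 - i : ℕ) : ℕ∞) := by
    refine (Set.encard_image_le _ _).trans ((Set.encard_le_encard (t := x '' Set.Ioi i) ?_).trans
      ((Set.encard_image_le _ _).trans (le_of_eq ?_)))
    · rintro _ ⟨⟨j, rfl⟩, hj⟩
      exact ⟨j, Set.mem_Ioi.mpr <| not_le.mp fun h => hj ⟨j, h, rfl⟩, rfl⟩
    · rw [← Finset.coe_Ioi, Set.encard_coe_eq_coe_finsetCard, Fin.card_Ioi]
  have h := hq.trans (ringKrullDim_le_of_span_eq_maximalIdeal
    (span_image_mk_diff_eq_maximalIdeal hx hsub') hcard')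
  have h' : n - i ≤ n - 1 - i := by exact_mod_cast h
  have := i.2
  omega

end RegularLocal

/-! ### Determinants over a regular sequence -/

section Determinants

/-- A regular sequence has only the trivial syzygies, in a form free of the Koszul complex: if
`∑ d_j x_j = 0` and the vector `c` is proportional to `x` modulo an ideal `J`, then
`∑ d_j c_j ∈ J`. -/
theorem sum_mul_mem_of_sum_mul_eq_zero {R : Type*} [CommRing R] {n : ℕ} {x : Fin n → R}
    (hx : ∀ i a, a * x i ∈ Ideal.span (x '' Set.Iio i) → a ∈ Ideal.span (x '' Set.Iio i))
    {J : Ideal R} {c : Fin n → R} (hc : ∀ p q, c p * x q - c q * x p ∈ J)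
    {d : Fin n → R} (hd : ∑ j, d j * x j = 0) : ∑ j, d j * c j ∈ J := by
  induction n with
  | zero => simp
  | succ n ih =>
    have himg : ∀ i : Fin n, (fun j : Fin n => x j.castSucc) '' Set.Iio i =
        x '' Set.Iio i.castSucc := by
      intro i
      rw [← Fin.image_castSucc_Iio, Set.image_image]
    have hlast : x '' Set.Iio (Fin.last n) = Set.range fun j : Fin n => x j.castSucc := by
      ext y
      constructor
      · rintro ⟨j, hj, rfl⟩
        exact ⟨j.castPred (ne_of_lt hj), by simp⟩
      · rintro ⟨j, rfl⟩
        exact ⟨_, Fin.castSucc_lt_last j, rfl⟩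
    rw [Fin.sum_univ_castSucc] at hd ⊢
    have hmem : d (Fin.last n) * x (Fin.last n) ∈ Ideal.span (x '' Set.Iio (Fin.last n)) := by
      rw [eq_neg_of_add_eq_zero_right hd, hlast]
      exact neg_mem (Ideal.sum_mem _ fun j _ =>
        Ideal.mul_mem_left _ _ (Ideal.subset_span ⟨j, rfl⟩))
    have h := hx _ _ hmem
    rw [hlast] at h
    obtain ⟨e, he⟩ := Ideal.mem_span_range_iff_exists_fun.mp h
    have hsum : ∑ j : Fin n, (d j.castSucc + e j * x (Fin.last n)) * x j.castSucc = 0 := by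
      rw [← hd, ← he, Finset.sum_mul, ← Finset.sum_add_distrib]
      exact Finset.sum_congr rfl fun j _ => by ring
    have h1 := ih (x := fun j => x j.castSucc) (c := fun j => c j.castSucc)
      (fun i a ha => by rw [himg] at ha ⊢; exact hx _ _ ha) (fun p q => hc _ _) hsum
    have h2 : ∑ j : Fin n, e j * (c (Fin.last n) * x j.castSucc - c j.castSucc * x (Fin.last n))
        ∈ J := Ideal.sum_mem _ fun j _ => Ideal.mul_mem_left _ _ (hc _ _)
    convert J.add_mem h1 h2 using 1
    rw [← he, Finset.sum_mul, ← Finset.sum_add_distrib, ← Finset.sum_add_distrib]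
    exact Finset.sum_congr rfl fun j _ => by ring

open Matrix

variable {R : Type*} [CommRing R] {n : ℕ}

theorem sum_adjugate_mul_mulVec (M : Matrix (Fin n) (Fin n) R) (f : Fin n → R) (j : Fin n) :
    ∑ l, M.adjugate j l * (M *ᵥ f) l = M.det * f j := by
  change (M.adjugate *ᵥ (M *ᵥ f)) j = _
  rw [Matrix.mulVec_mulVec, Matrix.adjugate_mul, Matrix.smul_mulVec, Matrix.one_mulVec]
  rfl

/-- Replacing one row of `B` by a syzygy `d` of a regular sequence `x` gives a determinant in the
ideal generated by the entries of `B x`. -/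
theorem det_updateRow_mem_of_sum_mul_eq_zero {x : Fin n → R}
    (hx : ∀ i a, a * x i ∈ Ideal.span (x '' Set.Iio i) → a ∈ Ideal.span (x '' Set.Iio i))
    (B : Matrix (Fin n) (Fin n) R) {J : Ideal R} (i : Fin n) (hB : ∀ l ≠ i, (B *ᵥ x) l ∈ J)
    {d : Fin n → R} (hd : ∑ j, d j * x j = 0) : (B.updateRow i d).det ∈ J := by
  -- Laplace expansion along row `i`; the cofactors are proportional to `x` modulo `J` by Cramer.
  have hexp : (B.updateRow i d).det = ∑ j, d j * B.adjugate j i := by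
    have h := congrFun (Matrix.cramer_eq_adjugate_mulVec Bᵀ d) i
    rw [Matrix.cramer_transpose_apply, ← Matrix.adjugate_transpose] at h
    rw [h]
    simp only [Matrix.mulVec, dotProduct, Matrix.transpose_apply, mul_comm]
  rw [hexp]
  refine sum_mul_mem_of_sum_mul_eq_zero hx (fun p q => ?_) hd
  set C := B.updateRow i (Pi.single p 1) with hC
  have hCx : ∑ l, C.adjugate q l * (C *ᵥ x) l = B.adjugate p i * x q := by
    rw [sum_adjugate_mul_mulVec, Matrix.adjugate_apply B p i]
  have hCq : C.adjugate q i = B.adjugate q i := by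
    rw [Matrix.adjugate_apply, Matrix.adjugate_apply, hC, Matrix.updateRow_idem]
  have hCi : (C *ᵥ x) i = x p := by
    simp [hC, Matrix.mulVec]
  rw [← hCx, ← Finset.add_sum_erase _ _ (Finset.mem_univ i), hCi, hCq, add_sub_cancel_left]
  refine Ideal.sum_mem _ fun l hl => Ideal.mul_mem_left _ _ ?_
  have hli := Finset.ne_of_mem_erase hl
  have : (C *ᵥ x) l = (B *ᵥ x) l := by simp [hC, Matrix.mulVec, Matrix.updateRow_ne hli]
  rw [this]
  exact hB l hli

/-- The determinant of a matrix `B` over a regular sequence `x` is determined modulo the ideal of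
the entries of `B x` by these entries. -/
theorem det_sub_det_mem {x : Fin n → R}
    (hx : ∀ i a, a * x i ∈ Ideal.span (x '' Set.Iio i) → a ∈ Ideal.span (x '' Set.Iio i))
    {B C : Matrix (Fin n) (Fin n) R} (h : B *ᵥ x = C *ᵥ x) :
    B.det - C.det ∈ Ideal.span (Set.range (B *ᵥ x)) := by
  classical
  set J := Ideal.span (Set.range (B *ᵥ x))
  -- The rows of `B` are replaced by those of `C` one at a time.
  let mix : Finset (Fin n) → Matrix (Fin n) (Fin n) R := fun s l => if l ∈ s then C l else B l
  have hmix : ∀ s, mix s *ᵥ x = B *ᵥ x := by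
    intro s
    ext l
    by_cases hl : l ∈ s
    · rw [h]; simp [Matrix.mulVec, mix, hl]
    · simp [Matrix.mulVec, mix, hl]
  have hmain : ∀ s, B.det - (mix s).det ∈ J := by
    intro s
    induction s using Finset.induction_on with
    | empty => simp [mix]
    | insert i s hi ih =>
      have h1 : mix (insert i s) = (mix s).updateRow i (C i) := by
        ext l m
        by_cases hl : l = i
        · subst hl
          rw [Matrix.updateRow_self]
          simp [mix]
        · rw [Matrix.updateRow_ne hl]
          simp [mix, hl]
      have h2 : mix s = (mix s).updateRow i (B i) := by
        ext l m
        by_cases hl : l = i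
        · subst hl
          rw [Matrix.updateRow_self]
          simp [mix, hi]
        · rw [Matrix.updateRow_ne hl]
      have h3 : (mix s).det - (mix (insert i s)).det =
          ((mix s).updateRow i (B i - C i)).det := by
        conv_lhs => rw [h1, h2, Matrix.updateRow_idem]
        exact (Matrix.detRowAlternating.map_update_sub (mix s) i (B i) (C i)).symm
      have h4 := det_updateRow_mem_of_sum_mul_eq_zero hx (mix s) (J := J) i
        (fun l _ => by rw [hmix]; exact Ideal.subset_span ⟨l, rfl⟩) (d := B i - C i) (by
          have h5 := congrFun h i
          simp only [Matrix.mulVec, dotProduct] at h5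
          simp [sub_mul, Finset.sum_sub_distrib, h5])
      rw [← h3] at h4
      convert J.add_mem ih h4 using 1
      ring
  have := hmain Finset.univ
  have h6 : mix Finset.univ = C := by ext l m; simp [mix]
  rwa [h6] at this

theorem det_mul_mem_span_range_mulVec (M : Matrix (Fin n) (Fin n) R) {f : Fin n → R} {e : R}
    (he : e ∈ Ideal.span (Set.range f)) : M.det * e ∈ Ideal.span (Set.range (M *ᵥ f)) := by
  obtain ⟨c, rfl⟩ := Ideal.mem_span_range_iff_exists_fun.mp he
  rw [Finset.mul_sum]
  refine Ideal.sum_mem _ fun j _ => ?_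
  rw [mul_left_comm, ← sum_adjugate_mul_mulVec]
  exact Ideal.mul_mem_left _ _ (Ideal.sum_mem _ fun l _ =>
    Ideal.mul_mem_left _ _ (Ideal.subset_span ⟨l, rfl⟩))

/-- If `x_i ^ a = ∑ M_ij f_j` and `f = B x` for a regular sequence `x`, then
`det M * det B ≡ ∏ x_i ^ (a - 1)` modulo `(x_1 ^ a, …, x_n ^ a)`: both `M * B` and the diagonal
matrix of the `x_i ^ (a - 1)` map `x` to the vector of the `x_i ^ a`. -/
theorem det_mul_det_sub_prod_mem {x f : Fin n → R}
    (hx : ∀ i a, a * x i ∈ Ideal.span (x '' Set.Iio i) → a ∈ Ideal.span (x '' Set.Iio i))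
    {a : ℕ} (ha : 0 < a) {M B : Matrix (Fin n) (Fin n) R} (hM : ∀ i, x i ^ a = (M *ᵥ f) i)
    (hB : f = B *ᵥ x) :
    M.det * B.det - ∏ i, x i ^ (a - 1) ∈ Ideal.span (Set.range fun i => x i ^ a) := by
  have h1 : (M * B) *ᵥ x = fun i => x i ^ a := by
    rw [← Matrix.mulVec_mulVec, ← hB]
    exact (funext hM).symm
  have h2 : Matrix.diagonal (fun i => x i ^ (a - 1)) *ᵥ x = fun i => x i ^ a := by
    ext i
    rw [Matrix.mulVec_diagonal, ← pow_succ, Nat.sub_add_cancel ha]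
  have h := det_sub_det_mem hx (h1.trans h2.symm)
  rwa [h1, Matrix.det_mul, Matrix.det_diagonal] at h

/-- The class of `det B` modulo `(f)`, where `f = B y` expresses `n` elements through generators
`y` of the maximal ideal, is multiplied by `det M` into the top monomial of any other generators
`x`, up to a unit. The unit collects the determinant of the change of generators from `x` to `y`
and the units `u_j` by which `f` may have been rescaled. -/
theorem exists_isUnit_det_mul_det_sub_mem [IsLocalRing R] [IsNoetherianRing R]
    (hdim : (n : WithBot ℕ∞) ≤ ringKrullDim R) {x y f : Fin n → R}
    (hx : Ideal.span (Set.range x) = maximalIdeal R)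
    (hy : Ideal.span (Set.range y) = maximalIdeal R)
    {a : ℕ} (ha : 0 < a) {M B : Matrix (Fin n) (Fin n) R} {u : Fin n → R}
    (hu : ∀ j, IsUnit (u j)) (hM : ∀ i, x i ^ a = (M *ᵥ f) i)
    (hf : ∀ j, f j = u j * (B *ᵥ y) j) :
    ∃ v : R, IsUnit v ∧
      M.det * B.det - v * ∏ i, x i ^ (a - 1) ∈ Ideal.span (Set.range fun i => x i ^ a) := by
  have hcomb : ∀ {p q : Fin n → R}, Ideal.span (Set.range p) = maximalIdeal R →
      Ideal.span (Set.range q) = maximalIdeal R → ∃ V : Matrix (Fin n) (Fin n) R, q = V *ᵥ p := by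
    intro p q hp hq
    have : ∀ i, ∃ c : Fin n → R, ∑ j, c j * p j = q i := fun i =>
      Ideal.mem_span_range_iff_exists_fun.mp (by rw [hp, ← hq]; exact Ideal.subset_span ⟨i, rfl⟩)
    choose V hV using this
    exact ⟨V, funext fun i => (hV i).symm⟩
  obtain ⟨V, hV⟩ := hcomb hx hy
  obtain ⟨W, hW⟩ := hcomb hy hx
  have hdetV : IsUnit V.det := by
    have hVW : (V * W) *ᵥ y = (1 : Matrix (Fin n) (Fin n) R) *ᵥ y := by
      rw [← Matrix.mulVec_mulVec, ← hW, ← hV, Matrix.one_mulVec]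
    have h := det_sub_det_mem (fun i a => mem_span_image_Iio_of_mul_mem hy hdim i) hVW
    rw [hVW, Matrix.one_mulVec, hy, Matrix.det_mul, Matrix.det_one] at h
    refine isUnit_of_mul_isUnit_left (y := W.det) ?_
    by_contra hnon
    have h1 := (maximalIdeal R).sub_mem ((mem_maximalIdeal _).mpr hnon) h
    rw [sub_sub_cancel] at h1
    exact (Ideal.ne_top_iff_one _).mp (maximalIdeal.isMaximal R).ne_top h1
  have hfB : f = (Matrix.diagonal u * (B * V)) *ᵥ x := by
    ext j
    rw [← Matrix.mulVec_mulVec, ← Matrix.mulVec_mulVec, ← hV, Matrix.mulVec_diagonal, hf]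
  have h := det_mul_det_sub_prod_mem (fun i a => mem_span_image_Iio_of_mul_mem hx hdim i) ha hM hfB
  rw [Matrix.det_mul, Matrix.det_mul, Matrix.det_diagonal] at h
  have hw : IsUnit ((∏ j, u j) * V.det) :=
    (IsUnit.prod_univ_iff.mpr hu).mul hdetV
  obtain ⟨w, hw⟩ := hw
  refine ⟨↑w⁻¹, w⁻¹.isUnit, ?_⟩
  convert Ideal.mul_mem_left _ (↑w⁻¹ : R) h using 1
  have hw1 : (↑w⁻¹ : R) * ((∏ j, u j) * V.det) = 1 := by rw [← hw]; simp
  linear_combination (- M.det * B.det) * hw1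

end Determinants

/-! ### Closed points of projective schemes -/

section Projective

theorem exists_homogeneous_mem_not_mem {A σ : Type*} [CommRing A] [SetLike σ A]
    [AddSubgroupClass σ A] (𝒜 : ℕ → σ) [GradedRing 𝒜] {I J : HomogeneousIdeal 𝒜}
    (h : ¬I ≤ J) : ∃ n, ∃ a ∈ 𝒜 n, a ∈ I ∧ a ∉ J := by
  obtain ⟨a, haI, haJ⟩ := SetLike.not_le_iff_exists.mp h
  by_contra! hall
  apply haJ
  classical
  rw [← DirectSum.sum_support_decompose 𝒜 a]
  exact J.toIdeal.sum_mem fun i _ =>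
    hall i _ (SetLike.coe_mem _) (I.isHomogeneous i haI)

/-- Homogeneous prime avoidance: some homogeneous element of positive degree lies in none of
finitely many incomparable points of `Proj`. A point `p` is added to the set by passing from `F` to
`F ^ e + G ^ d`, where `G` vanishes at all earlier points but not at `p`. -/
theorem exists_homogeneous_forall_not_mem {A σ : Type*} [CommRing A] [SetLike σ A]
    [AddSubgroupClass σ A] (𝒜 : ℕ → σ) [GradedRing 𝒜] (s : Finset (ProjectiveSpectrum 𝒜))
    (hs : ∀ p ∈ s, ∀ q ∈ s, p.asHomogeneousIdeal ≤ q.asHomogeneousIdeal → p = q) :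
    ∃ m, 0 < m ∧ ∃ f ∈ 𝒜 m, ∀ p ∈ s, f ∉ p.asHomogeneousIdeal := by
  classical
  induction s using Finset.induction_on with
  | empty => exact ⟨1, one_pos, 0, zero_mem _, by simp⟩
  | insert p s hp ih =>
    obtain ⟨d, hd, F, hF, hFs⟩ := ih fun q hq q' hq' =>
      hs q (Finset.mem_insert_of_mem hq) q' (Finset.mem_insert_of_mem hq')
    by_cases hFp : F ∈ p.asHomogeneousIdeal
    swap
    · refine ⟨d, hd, F, hF, fun q hq => ?_⟩
      obtain rfl | hq := Finset.mem_insert.mp hq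
      exacts [hFp, hFs q hq]
    obtain ⟨e₀, g₀, hg₀, hg₀p, hg₀i⟩ : ∃ e, ∃ g ∈ 𝒜 e, g ∉ p.asHomogeneousIdeal ∧ 0 < e := by
      obtain ⟨e, g, hg, hgi, hgp⟩ := exists_homogeneous_mem_not_mem 𝒜 p.not_irrelevant_le
      refine ⟨e, g, hg, hgp, Nat.pos_of_ne_zero ?_⟩
      rintro rfl
      rw [HomogeneousIdeal.mem_irrelevant_iff, GradedRing.proj_apply,
        DirectSum.decompose_of_mem_same 𝒜 hg] at hgi
      exact hgp (hgi ▸ zero_mem _)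
    have hsep : ∀ q : s, ∃ n, ∃ a ∈ 𝒜 n, a ∈ q.1.asHomogeneousIdeal ∧
        a ∉ p.asHomogeneousIdeal := fun q =>
      exists_homogeneous_mem_not_mem 𝒜 fun hle =>
        hp (hs q.1 (Finset.mem_insert_of_mem q.2) p (Finset.mem_insert_self _ _) hle ▸ q.2)
    choose n a ha haq hap using hsep
    set G := g₀ * ∏ q : s, a q with hG
    set e := e₀ + ∑ q : s, n q with he
    have hGe : G ∈ 𝒜 e :=
      SetLike.mul_mem_graded hg₀ (SetLike.prod_mem_graded 𝒜 n a fun q _ => ha q)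
    have hGp : G ∉ p.asHomogeneousIdeal := by
      intro h
      obtain h | h := p.isPrime.mem_or_mem h
      · exact hg₀p h
      · obtain ⟨q, -, hq⟩ := p.isPrime.prod_mem_iff.mp h
        exact hap q hq
    have hGs : ∀ q ∈ s, G ∈ q.asHomogeneousIdeal := fun q hq =>
      q.asHomogeneousIdeal.toIdeal.mul_mem_left _
        (Ideal.mem_of_dvd _ (Finset.dvd_prod_of_mem a (Finset.mem_univ ⟨q, hq⟩)) (haq ⟨q, hq⟩))
    have hepos : 0 < e := by omega
    refine ⟨e * d, Nat.mul_pos hepos hd, F ^ e + G ^ d, add_mem ?_ ?_, fun q hq h => ?_⟩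
    · exact SetLike.pow_mem_graded e hF
    · rw [mul_comm]; exact SetLike.pow_mem_graded d hGe
    · obtain rfl | hq := Finset.mem_insert.mp hq
      · refine hGp (q.isPrime.mem_of_pow_mem d ?_)
        exact (Ideal.add_mem_iff_right _ (Ideal.pow_mem_of_mem _ hFp e hepos)).mp h
      · refine hFs q hq (q.isPrime.mem_of_pow_mem e ?_)
        exact (Ideal.add_mem_iff_left _ (Ideal.pow_mem_of_mem _ (hGs q hq) d hd)).mp h

attribute [local instance] MvPolynomial.gradedAlgebra

/-- Finitely many closed points of a projective scheme lie in a common affine open. -/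
theorem exists_affineOpens_of_finite {k : Type u} [Field k] {X : Scheme.{u}}
    {π : X ⟶ Spec (.of k)} (hπ : IsProjective π) {Z : Set X} (hZ : Z.Finite)
    (hcl : ∀ P ∈ Z, IsClosed ({P} : Set X)) : ∃ U : X.affineOpens, ∀ P ∈ Z, P ∈ U.1 := by
  classical
  obtain ⟨n, i, hi, -⟩ := hπ
  let 𝒜 := MvPolynomial.homogeneousSubmodule (Fin (n + 1)) k
  let j : X → ProjectiveSpectrum 𝒜 := fun P => i P
  obtain ⟨m, hm, f, hf, hfs⟩ := exists_homogeneous_forall_not_mem 𝒜 (hZ.toFinset.image j) (by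
    intro p hp q hq hpq
    obtain ⟨P, hP, rfl⟩ := Finset.mem_image.mp hp
    have hclosed : IsClosed ({j P} : Set (ProjectiveSpectrum 𝒜)) := by
      have h := (i.isClosedEmbedding.isClosedMap _ (hcl P (hZ.mem_toFinset.mp hP)))
      rwa [Set.image_singleton] at h
    have h := (ProjectiveSpectrum.le_iff_mem_closure 𝒜 (j P) q).mp hpq
    rw [hclosed.closure_eq] at h
    exact h.symm)
  have hU : IsAffineOpen (Proj.basicOpen 𝒜 f) := Proj.isAffineOpen_basicOpen 𝒜 f hf hm
  exact ⟨⟨_, IsAffineOpen.preimage (Y := projSpace k n) hU i⟩, fun P hP =>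
    hfs _ (Finset.mem_image_of_mem j (hZ.mem_toFinset.mpr hP))⟩

/-- Projective space is covered by the finitely many affine opens `D₊(X_j)`. -/
instance compactSpace_projSpace {k : Type u} [Field k] (n : ℕ) :
    CompactSpace (projSpace k n) := by
  let 𝒜 := MvPolynomial.homogeneousSubmodule (Fin (n + 1)) k
  have hcover : ⨆ j, Proj.basicOpen 𝒜 (MvPolynomial.X j) = ⊤ := by
    refine Proj.iSup_basicOpen_eq_top' 𝒜 _
      (fun j => ⟨1, MvPolynomial.isHomogeneous_X k j⟩) (top_le_iff.mp fun p _ => ?_)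
    induction p using MvPolynomial.induction_on with
    | C a => exact Subalgebra.algebraMap_mem _ (⟨_, MvPolynomial.isHomogeneous_C _ a⟩ : 𝒜 0)
    | add p q hp hq => exact add_mem (hp trivial) (hq trivial)
    | mul_X p j hp => exact mul_mem (hp trivial) (Algebra.subset_adjoin ⟨j, rfl⟩)
  constructor
  have h : (Set.univ : Set (projSpace k n)) =
      ⋃ j, (Proj.basicOpen 𝒜 (MvPolynomial.X j) : Set (Proj 𝒜)) := by
    rw [← TopologicalSpace.Opens.coe_iSup, hcover]
    rfl
  rw [h]
  exact isCompact_iUnion fun j =>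
    (Proj.isAffineOpen_basicOpen 𝒜 _ (MvPolynomial.isHomogeneous_X k j) one_pos).isCompact

theorem IsSmoothProjectiveVariety.isNoetherian {k : Type u} [Field k] {X : Scheme.{u}}
    {π : X ⟶ Spec (.of k)} {r : ℕ} (h : IsSmoothProjectiveVariety π r) : IsNoetherian X := by
  obtain ⟨n, i, hi, -⟩ := h.projective
  have := h.smooth
  have : IsLocallyNoetherian X := LocallyOfFiniteType.isLocallyNoetherian π
  have : CompactSpace X := i.isClosedEmbedding.compactSpace
  exact {}

end Projective

/-! ### Proper intersections -/

section ProperIntersection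

theorem isClosed_inter {X : Scheme.{u}} {r : ℕ} (D : Fin r → EffectiveDivisor X) :
    IsClosed (inter D) := by
  have : inter D = ⋂ l, ((D l).idealSheaf.support : Set X) := by ext; simp [inter]
  rw [this]
  exact isClosed_iInter fun l => (D l).idealSheaf.support.isClosed

theorem lt_of_specializes_of_ne {X : Scheme.{u}} {P Q : X} (h : P ⤳ Q) (hne : P ≠ Q) : Q < P :=
  lt_of_le_not_ge h fun h' => hne (h.antisymm h').eq

theorem coheight_le_of_topologicalKrullDim_eq {X : Scheme.{u}} {r : ℕ}
    (hX : topologicalKrullDim X = r) (P : X) : Order.coheight P ≤ r := by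
  have h : (Order.coheight P : WithBot ℕ∞) ≤ r := by
    refine (Order.coheight_le_krullDim P).trans ?_
    rw [← hX, topologicalKrullDim]
    exact (Order.krullDim_eq_of_orderIso (irreducibleSetEquivPoints (α := X))).ge
  exact_mod_cast h

/-- A point whose local ring has dimension `dim X` is closed, since the dimension of the local ring
strictly increases under proper specialization. -/
theorem isClosed_singleton_of_ringKrullDim_stalk_eq {X : Scheme.{u}} {r : ℕ}
    (hX : topologicalKrullDim X = r) {P : X} (hP : ringKrullDim (X.presheaf.stalk P) = r) :
    IsClosed ({P} : Set X) := by
  rw [← closure_eq_iff_isClosed]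
  refine Set.Subset.antisymm (fun Q hQ => ?_) subset_closure
  by_contra hne
  have h1 := Order.coheight_add_one_le
    (lt_of_specializes_of_ne (specializes_iff_mem_closure.mpr hQ) (Ne.symm hne))
  rw [ringKrullDim_stalk_eq_coheight] at hP
  have h3 : Order.coheight P = r := by exact_mod_cast hP
  have h5 := h1.trans (coheight_le_of_topologicalKrullDim_eq hX Q)
  rw [h3] at h5
  exact absurd h5 (by norm_cast; omega)

/-- If `D_1, …, D_r` intersect properly on an `r`-dimensional scheme, then the intersection
consists of closed points with local rings of dimension `r`. -/
theorem IntersectProperly.isClosed_and_ringKrullDim {X : Scheme.{u}} {r : ℕ}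
    {D : Fin r → EffectiveDivisor X} (hD : IntersectProperly D)
    (hX : topologicalKrullDim X = r) {P : X} (hP : P ∈ inter D) :
    IsClosed ({P} : Set X) ∧ ringKrullDim (X.presheaf.stalk P) = r := by
  -- A generization of `P` in the intersection with local ring of least dimension.
  obtain ⟨Q, ⟨hQ, hQP⟩, hmin⟩ := (InvImage.wf (Order.coheight : X → ℕ∞) wellFounded_lt).has_min
    {Q | Q ∈ inter D ∧ Q ⤳ P} ⟨P, hP, specializes_rfl⟩
  have hQdim : ringKrullDim (X.presheaf.stalk Q) = r := by
    refine hD Q hQ fun Q' hQ' hle => ?_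
    by_contra hne
    refine hmin Q' ⟨hQ', hle.trans hQP⟩ ?_
    exact Order.coheight_strictAnti (lt_of_specializes_of_ne hle hne)
      ((coheight_le_of_topologicalKrullDim_eq hX Q').trans_lt (ENat.natCast_lt_top r))
  have hcl := isClosed_singleton_of_ringKrullDim_stalk_eq hX hQdim
  have hPQ : P = Q := by simpa [hcl.closure_eq] using hQP.mem_closure
  rw [hPQ]
  exact ⟨hcl, hQdim⟩

theorem IntersectProperly.finite_inter {X : Scheme.{u}} [IsNoetherian X] {r : ℕ}
    {D : Fin r → EffectiveDivisor X} (hD : IntersectProperly D)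
    (hX : topologicalKrullDim X = r) : (inter D).Finite := by
  obtain ⟨T, hT, hcl, hirr, hcover⟩ :=
    TopologicalSpace.NoetherianSpace.exists_finite_set_isClosed_irreducible (isClosed_inter D)
  rw [hcover]
  refine hT.sUnion fun t ht => ?_
  obtain ⟨η, hη⟩ := QuasiSober.sober (hirr t ht) (hcl t ht)
  have hmem : η ∈ inter D := hcover ▸ ⟨t, ht, hη.mem⟩
  have hclη := (hD.isClosed_and_ringKrullDim hX hmem).1
  rw [← hη.def, hclη.closure_eq]
  exact Set.finite_singleton η

end ProperIntersection

/-! ### Germs and their approximation -/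

section Stalks

/-- A ring and its localization at a maximal ideal have the same quotients by powers of that
ideal; this is the surjectivity. -/
theorem exists_algebraMap_sub_mem_maximalIdeal_pow {R S : Type*} [CommRing R] [CommRing S]
    [Algebra R S] [IsLocalRing S] (p : Ideal R) [hp : p.IsMaximal] [IsLocalization.AtPrime S p]
    (t : S) (N : ℕ) : ∃ a : R, algebraMap R S a - t ∈ IsLocalRing.maximalIdeal S ^ N := by
  obtain ⟨b, s, rfl⟩ := IsLocalization.exists_mk'_eq p.primeCompl t
  have hcop : IsCoprime (Ideal.span {s.1}) (p ^ N) := by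
    refine IsCoprime.pow_right ?_
    rw [isCoprime_comm, Ideal.isCoprime_iff_sup_eq]
    refine hp.1.2 _ (lt_of_le_of_ne le_sup_left fun h => s.2 ?_)
    exact h.ge (Ideal.mem_sup_right (Ideal.mem_span_singleton_self _))
  obtain ⟨w, hw, q, hq, hwq⟩ := Ideal.isCoprime_iff_exists.mp hcop
  obtain ⟨c, rfl⟩ := Ideal.mem_span_singleton'.mp hw
  refine ⟨c * b, ?_⟩
  have hspec := IsLocalization.mk'_spec S b s
  have h1 : algebraMap R S c * algebraMap R S s + algebraMap R S q = 1 := by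
    rw [← map_mul, ← map_add, hwq, map_one]
  have h2 : algebraMap R S (c * b) - IsLocalization.mk' S b s =
      -(IsLocalization.mk' S b s * algebraMap R S q) := by
    rw [map_mul]
    linear_combination (-algebraMap R S c) * hspec + IsLocalization.mk' S b s * h1
  rw [h2]
  refine neg_mem (Ideal.mul_mem_left _ _ ?_)
  rw [← IsLocalization.AtPrime.map_eq_maximalIdeal p S, ← Ideal.map_pow]
  exact Ideal.mem_map_of_mem _ hq

theorem exists_germ_sub_mem_maximalIdeal_pow {X : Scheme.{u}} {U : X.Opens} (hU : IsAffineOpen U)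
    (P : U) (hcl : IsClosed ({P.1} : Set X)) (t : X.presheaf.stalk P.1) (N : ℕ) :
    ∃ a : Γ(X, U), X.presheaf.germ U P.1 P.2 a - t ∈
      IsLocalRing.maximalIdeal (X.presheaf.stalk P.1) ^ N := by
  have := hU.isLocalization_stalk P
  have := hU.primeIdealOf_isMaximal_of_isClosed P hcl
  exact exists_algebraMap_sub_mem_maximalIdeal_pow (hU.primeIdealOf P).asIdeal t N

theorem germ_mem_maximalIdeal_pow {X : Scheme.{u}} {U : X.Opens} (hU : IsAffineOpen U)
    (P : U) {N : ℕ} {a : Γ(X, U)} (ha : a ∈ (hU.primeIdealOf P).asIdeal ^ N) :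
    X.presheaf.germ U P.1 P.2 a ∈ IsLocalRing.maximalIdeal (X.presheaf.stalk P.1) ^ N := by
  have := hU.isLocalization_stalk P
  rw [← IsLocalization.AtPrime.map_eq_maximalIdeal (hU.primeIdealOf P).asIdeal
    (X.presheaf.stalk P.1), ← Ideal.map_pow]
  exact Ideal.mem_map_of_mem (algebraMap Γ(X, U) (X.presheaf.stalk P.1)) ha

/-- Germs at finitely many closed points of an affine open are approximated simultaneously by one
section, modulo powers of the maximal ideals. -/
theorem exists_section_forall_germ_sub_mem {X : Scheme.{u}} {U : X.Opens} (hU : IsAffineOpen U)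
    {Z : Set X} (hZ : Z.Finite) (hcl : ∀ P ∈ Z, IsClosed ({P} : Set X)) (hZU : ∀ P ∈ Z, P ∈ U)
    (t : ∀ P : X, X.presheaf.stalk P) (N : X → ℕ) :
    ∃ a : Γ(X, U), ∀ (P : X) (hP : P ∈ Z), X.presheaf.germ U P (hZU P hP) a - t P ∈
      IsLocalRing.maximalIdeal (X.presheaf.stalk P) ^ N P := by
  have : Finite Z := hZ
  let pt : Z → U := fun P => ⟨P.1, hZU P.1 P.2⟩
  have hmax : ∀ P : Z, (hU.primeIdealOf (pt P)).asIdeal.IsMaximal := fun P =>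
    hU.primeIdealOf_isMaximal_of_isClosed (pt P) (hcl P.1 P.2)
  have happrox := fun P : Z =>
    exists_germ_sub_mem_maximalIdeal_pow hU (pt P) (hcl P.1 P.2) (t P.1) (N P.1)
  choose b hb using happrox
  have hcop : Pairwise (Function.onFun IsCoprime
      fun P : Z => (hU.primeIdealOf (pt P)).asIdeal ^ N P.1) := by
    intro P Q hPQ
    have := hmax P
    have := hmax Q
    refine (Ideal.isCoprime_of_isMaximal fun h => hPQ (Subtype.ext ?_)).pow
    have h' : hU.primeIdealOf (pt P) = hU.primeIdealOf (pt Q) := PrimeSpectrum.ext h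
    have h'' := congrArg hU.fromSpec h'
    rwa [hU.fromSpec_primeIdealOf, hU.fromSpec_primeIdealOf] at h''
  obtain ⟨a, ha⟩ := Ideal.exists_forall_sub_mem_ideal hcop b
  refine ⟨a, fun P hP => ?_⟩
  have h1 := germ_mem_maximalIdeal_pow hU (pt ⟨P, hP⟩) (ha ⟨P, hP⟩)
  have h2 := Ideal.add_mem _ h1 (hb ⟨P, hP⟩)
  rwa [map_sub, sub_add_sub_cancel] at h2

/-- The residue field at a rational point is the base field: pull a germ back along the section of
`π` and compare with the constant it becomes there. -/
theorem IsRationalPoint.exists_sub_constants_mem {k : Type u} [Field k] {X : Scheme.{u}}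
    {π : X ⟶ Spec (.of k)} {P : X} (hP : IsRationalPoint π P) (v : X.presheaf.stalk P) :
    ∃ c : k, v - constants π P c ∈ IsLocalRing.maximalIdeal (X.presheaf.stalk P) := by
  obtain ⟨s, hs, y, rfl⟩ := hP
  have : Subsingleton (Spec (.of k)) := inferInstanceAs (Subsingleton (PrimeSpectrum k))
  obtain ⟨a, ha⟩ := exists_germ_sub_mem_maximalIdeal_pow (isAffineOpen_top (Spec (.of k)))
    ⟨y, trivial⟩ (Set.subsingleton_of_subsingleton.isClosed) (s.stalkMap y v) 1
  rw [pow_one] at ha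
  refine ⟨(Scheme.ΓSpecIso (.of k)).hom a, ?_⟩
  have hconst : constants π (s y) ((Scheme.ΓSpecIso (.of k)).hom a) =
      X.presheaf.germ ⊤ (s y) trivial (π.appTop a) := by
    simp [constants]
  have hpull : s.stalkMap y (X.presheaf.germ ⊤ (s y) trivial (π.appTop a)) =
      (Spec (.of k)).presheaf.germ ⊤ y trivial a := by
    have h1 : (π.appTop ≫ X.presheaf.germ ⊤ (s y) trivial) ≫ s.stalkMap y =
        (Spec (.of k)).presheaf.germ ⊤ y trivial := by
      have h2 : π.appTop ≫ s.app ⊤ = 𝟙 _ := by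
        have h3 : (s ≫ π).appTop = 𝟙 _ := by rw [hs]; simp
        simpa using h3
      have h0 : X.presheaf.germ ⊤ (s y) trivial ≫ s.stalkMap y =
        s.app ⊤ ≫ (Spec (.of k)).presheaf.germ ⊤ y trivial := s.germ_stalkMap ⊤ y trivial
      refine (Category.assoc _ _ _).trans ((congrArg (π.appTop ≫ ·) h0).trans ?_)
      refine (Category.assoc _ _ _).symm.trans ?_
      refine (congrArg (· ≫ (Spec (.of k)).presheaf.germ ⊤ y trivial) h2).trans ?_
      exact Category.id_comp _
    exact congrArg (fun φ => φ.hom a) h1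
  rw [hconst, IsLocalRing.mem_maximalIdeal, mem_nonunits_iff]
  intro hu
  have h4 := hu.map (s.stalkMap y).hom
  rw [map_sub] at h4
  erw [hpull] at h4
  have h5 := neg_mem ha
  rw [neg_sub] at h5
  exact (IsLocalRing.mem_maximalIdeal _).mp h5 h4

/-- The ideal of `𝒪_P` generated by a local equation is the stalk of the ideal sheaf, whichever
affine open the equation is taken on: compare on a common basic open neighbourhood of `P`. -/
theorem EffectiveDivisor.IsLocalEquation.span_eq {X : Scheme.{u}} {D : EffectiveDivisor X} {P : X}
    {f g : X.presheaf.stalk P} (hf : D.IsLocalEquation P f) (hg : D.IsLocalEquation P g) :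
    Ideal.span {f} = Ideal.span {g} := by
  obtain ⟨U, hU, f, hfU, rfl⟩ := hf
  obtain ⟨V, hV, g, hgV, rfl⟩ := hg
  obtain ⟨a, b, hab, hPa⟩ := exists_basicOpen_le_affine_inter U.2 V.2 P ⟨hU, hV⟩
  let W : X.affineOpens := X.affineBasicOpen a
  have hWU : W ≤ U := X.affineBasicOpen_le a
  have hWV : W ≤ V := by
    change X.basicOpen a ≤ V.1
    rw [hab]
    exact X.basicOpen_le b
  have key : ∀ (T : X.affineOpens) (hT : P ∈ T.1) (hWT : W ≤ T) (h : Γ(X, T.1)),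
      D.idealSheaf.ideal T = Ideal.span {h} →
      Ideal.span {X.presheaf.germ T.1 P hT h} =
        (D.idealSheaf.ideal W).map (X.presheaf.germ W.1 P hPa).hom := by
    intro T hT hWT h hh
    rw [← D.idealSheaf.map_ideal hWT, hh, Ideal.map_span, Ideal.map_span, Set.image_singleton,
      Set.image_singleton]
    congr 2
    exact (X.presheaf.germ_res_apply (homOfLE hWT) P hPa h).symm
  rw [key U hU hWU f hfU, key V hV hWV g hgV]

theorem EffectiveDivisor.IsLocalEquation.mem_maximalIdeal {X : Scheme.{u}} {D : EffectiveDivisor X}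
    {P : X} {f : X.presheaf.stalk P} (hf : D.IsLocalEquation P f) (hP : P ∈ D.idealSheaf.support) :
    f ∈ IsLocalRing.maximalIdeal (X.presheaf.stalk P) := by
  obtain ⟨U, hU, g, hg, rfl⟩ := hf
  rw [Scheme.IdealSheafData.mem_support_iff_of_mem hU, Scheme.mem_zeroLocus_iff] at hP
  have h := hP g (by rw [hg]; exact Ideal.mem_span_singleton_self g)
  rwa [Scheme.mem_basicOpen _ _ _ hU] at h

end Stalks

/-! ### Rectifying germs and functions -/

section Assembly

theorem mul_prod_pow_mem_span_range_pow {R : Type*} [CommRing R] {n : ℕ} {x : Fin n → R} {a : ℕ}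
    (ha : 0 < a) {e : R} (he : e ∈ Ideal.span (Set.range x)) :
    e * ∏ i, x i ^ (a - 1) ∈ Ideal.span (Set.range fun i => x i ^ a) := by
  obtain ⟨c, rfl⟩ := Ideal.mem_span_range_iff_exists_fun.mp he
  rw [Finset.sum_mul]
  refine Ideal.sum_mem _ fun i _ => ?_
  have h : c i * x i * ∏ j, x j ^ (a - 1) =
      (c i * ∏ j ∈ Finset.univ.erase i, x j ^ (a - 1)) * x i ^ a := by
    rw [← Finset.mul_prod_erase _ _ (Finset.mem_univ i)]
    have : x i ^ a = x i * x i ^ (a - 1) := by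
      rw [← pow_succ', Nat.sub_add_cancel ha]
    rw [this]
    ring
  rw [h]
  exact Ideal.mul_mem_left _ _ (Ideal.subset_span ⟨i, rfl⟩)

namespace LocalChoice

variable {X : Scheme.{u}} {r : ℕ} {D : Fin r → EffectiveDivisor X} {P : X}

theorem span_range_f_eq (L L' : LocalChoice D P) :
    Ideal.span (Set.range L.f) = Ideal.span (Set.range L'.f) := by
  rw [← Set.iUnion_singleton_eq_range, ← Set.iUnion_singleton_eq_range, Ideal.span_iUnion,
    Ideal.span_iUnion]
  exact iSup_congr fun j => (L.isLocalEquation j).span_eq (L'.isLocalEquation j)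

theorem exists_maximalIdeal_pow_le (L : LocalChoice D P) :
    ∃ N, maximalIdeal (X.presheaf.stalk P) ^ N ≤ Ideal.span (Set.range L.f) := by
  refine Ideal.exists_pow_le_of_le_radical_of_fg ?_ ?_
  · rw [← L.span_x, Ideal.span_le]
    rintro _ ⟨i, rfl⟩
    refine ⟨L.a, ?_⟩
    rw [L.pow_eq]
    exact Ideal.sum_mem _ fun j _ => Ideal.mul_mem_left _ _ (Ideal.subset_span ⟨j, rfl⟩)
  · rw [← L.span_x]
    exact Submodule.fg_span (Set.finite_range _)

theorem R_mul_mem_powIdeal (L : LocalChoice D P) {e : X.presheaf.stalk P}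
    (he : e ∈ Ideal.span (Set.range L.f)) : L.R * e ∈ L.powIdeal := by
  have h := det_mul_mem_span_range_mulVec L.M he
  have h' : L.M.mulVec L.f = fun i => L.x i ^ L.a := (funext L.pow_eq).symm
  rwa [h'] at h

/-- With `f = B x` for one choice at `P`, the germ `t = det B` serves all choices: for each of them
the product `R t` is a unit multiple of the top monomial modulo the powers. -/
theorem exists_forall_R_mul_sub_mem [IsIntegral X] [IsNoetherianRing (X.presheaf.stalk P)]
    (hdim : ringKrullDim (X.presheaf.stalk P) = r) (hP : P ∈ inter D) (L : LocalChoice D P) :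
    ∃ t, ∀ L' : LocalChoice D P, ∃ v, IsUnit v ∧
      L'.R * t - v * L'.topMonomial ∈ L'.powIdeal := by
  have hB : ∀ j, ∃ c : Fin r → X.presheaf.stalk P, ∑ i, c i * L.x i = L.f j := fun j => by
    rw [← Ideal.mem_span_range_iff_exists_fun, L.span_x]
    exact (L.isLocalEquation j).mem_maximalIdeal (hP j)
  choose B hB using hB
  refine ⟨Matrix.det B, fun L' => ?_⟩
  have hu : ∀ j, ∃ u, IsUnit u ∧ L'.f j = u * L.f j := fun j => by
    obtain ⟨u, hu⟩ := Ideal.span_singleton_eq_span_singleton.mp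
      ((L.isLocalEquation j).span_eq (L'.isLocalEquation j))
    exact ⟨u, u.isUnit, by rw [← hu, mul_comm]⟩
  choose u hu hfu using hu
  exact exists_isUnit_det_mul_det_sub_mem hdim.ge L'.span_x L.span_x L'.a_pos hu L'.pow_eq
    fun j => (hfu j).trans (congrArg (u j * ·) (hB j).symm)

end LocalChoice

/-- At a point of the intersection the strict rectifying condition holds for all germs in some
residue class modulo a power of the maximal ideal. -/
theorem exists_forall_sub_mem_rectifying {k : Type u} [Field k] {X : Scheme.{u}} [IsIntegral X]
    (π : X ⟶ Spec (.of k)) {r : ℕ} {D : Fin r → EffectiveDivisor X} {S : Set X}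
    (hrat : ∀ P ∈ S, IsRationalPoint π P) {P : X} [IsNoetherianRing (X.presheaf.stalk P)]
    (hP : P ∈ inter D) (hdim : ringKrullDim (X.presheaf.stalk P) = r) :
    ∃ (t₀ : X.presheaf.stalk P) (N : ℕ), ∀ t, t - t₀ ∈ maximalIdeal (X.presheaf.stalk P) ^ N →
      ∀ L : LocalChoice D P,
        (P ∈ S → ∃ c : k, c ≠ 0 ∧ L.R * t - constants π P c * L.topMonomial ∈ L.powIdeal) ∧
        (P ∉ S → L.R * t ∈ L.powIdeal) := by
  by_cases hL : Nonempty (LocalChoice D P)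
  swap
  -- Parameters exist at every closed point of a smooth variety; without them nothing is asked.
  · exact ⟨0, 0, fun t _ L => absurd ⟨L⟩ hL⟩
  obtain ⟨L₀⟩ := hL
  obtain ⟨N, hN⟩ := L₀.exists_maximalIdeal_pow_le
  obtain ⟨g, hg⟩ := L₀.exists_forall_R_mul_sub_mem hdim hP
  by_cases hPS : P ∈ S
  · refine ⟨g, N, fun t ht L => ⟨fun _ => ?_, fun h => absurd hPS h⟩⟩
    obtain ⟨v, hv, hvL⟩ := hg L
    obtain ⟨c, hc⟩ := (hrat P hPS).exists_sub_constants_mem v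
    refine ⟨c, ?_, ?_⟩
    · rintro rfl
      rw [map_zero, sub_zero] at hc
      exact (mem_maximalIdeal _).mp hc hv
    · have h1 := L.R_mul_mem_powIdeal (L.span_range_f_eq L₀ ▸ hN ht)
      have h2 : (v - constants π P c) * L.topMonomial ∈ L.powIdeal :=
        mul_prod_pow_mem_span_range_pow L.a_pos (L.span_x ▸ hc)
      convert L.powIdeal.add_mem (L.powIdeal.add_mem h1 hvL) h2 using 1
      ring
  · refine ⟨0, N, fun t ht L => ⟨fun h => absurd h hPS, fun _ => ?_⟩⟩
    rw [sub_zero] at ht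
    exact L.R_mul_mem_powIdeal (L.span_range_f_eq L₀ ▸ hN ht)

theorem IsStrictlyRectifying.isRectifying {k : Type u} [Field k] {X : Scheme.{u}} [IsIntegral X]
    {π : X ⟶ Spec (.of k)} {r : ℕ} {D : Fin r → EffectiveDivisor X} {S : Set X}
    {θ : X.functionField} (h : IsStrictlyRectifying π D S θ) : IsRectifying π D S θ := by
  intro P hP
  obtain ⟨t, ht, hL⟩ := h P hP
  exact ⟨t, ht, fun L => ⟨fun hPS => ((hL L).1 hPS).imp fun _ hc => hc.2, (hL L).2⟩⟩

theorem exists_isStrictlyRectifying {k : Type u} [Field k] {X : Scheme.{u}} [IsIntegral X]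
    (π : X ⟶ Spec (.of k)) {r : ℕ} (hX : IsSmoothProjectiveVariety π r)
    {D : Fin r → EffectiveDivisor X} (hD : IntersectProperly D) {S : Set X}
    (hrat : ∀ P ∈ S, IsRationalPoint π P) :
    ∃ θ : X.functionField, IsStrictlyRectifying π D S θ := by
  have := hX.isNoetherian
  have hpt := fun P (hP : P ∈ inter D) => hD.isClosed_and_ringKrullDim hX.dim_eq hP
  have hfin := hD.finite_inter hX.dim_eq
  obtain ⟨U, hU⟩ := exists_affineOpens_of_finite hX.projective hfin fun P hP => (hpt P hP).1
  have hloc : ∀ P : X, ∃ (t₀ : X.presheaf.stalk P) (N : ℕ), P ∈ inter D →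
      ∀ t, t - t₀ ∈ maximalIdeal (X.presheaf.stalk P) ^ N → ∀ L : LocalChoice D P,
        (P ∈ S → ∃ c : k, c ≠ 0 ∧ L.R * t - constants π P c * L.topMonomial ∈ L.powIdeal) ∧
        (P ∉ S → L.R * t ∈ L.powIdeal) := by
    intro P
    by_cases hP : P ∈ inter D
    · obtain ⟨t₀, N, h⟩ := exists_forall_sub_mem_rectifying π hrat hP (hpt P hP).2
      exact ⟨t₀, N, fun _ => h⟩
    · exact ⟨0, 0, fun h => absurd h hP⟩
  choose t₀ N hloc using hloc
  obtain ⟨a, ha⟩ :=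
    exists_section_forall_germ_sub_mem U.2 hfin (fun P hP => (hpt P hP).1) hU t₀ N
  -- The affine open may be empty if the intersection is, and then has no germ at the generic point.
  rcases (inter D).eq_empty_or_nonempty with hempty | ⟨Q, hQ⟩
  · exact ⟨0, fun P hP => by simp [hempty] at hP⟩
  have : Nonempty U.1 := ⟨⟨Q, hU Q hQ⟩⟩
  refine ⟨X.germToFunctionField U.1 a, fun P hP => ⟨X.presheaf.germ U.1 P (hU P hP) a, ?_,
    hloc P hP _ (ha P hP)⟩⟩
  exact X.presheaf.germ_stalkSpecializes_apply _ _ _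

end Assembly

end RectifyingFunctions

theorem corollary4p8 {k : Type u} [Field k] [Finite k] {X : Scheme.{u}} [IsIntegral X]
    (π : X ⟶ Spec (.of k)) (r : ℕ) (hX : RectifyingFunctions.IsSmoothProjectiveVariety π r)
    (D : Fin r → RectifyingFunctions.EffectiveDivisor X)
    (hD : RectifyingFunctions.IntersectProperly D)
    (S : Set X) (hS : S ⊆ RectifyingFunctions.inter D)
    (hrat : ∀ P ∈ S, RectifyingFunctions.IsRationalPoint π P) :
    ∃ θ : X.functionField, RectifyingFunctions.IsRectifying π D S θ ∧
      RectifyingFunctions.IsStrictlyRectifying π D S θ := by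
  obtain ⟨θ, hθ⟩ := RectifyingFunctions.exists_isStrictlyRectifying π hX hD hrat
  exact ⟨θ, hθ.isRectifying, hθ⟩
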